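/- Let $n\ge 5$, let $A_n\le S_n$ be the alternating and symmetric groups on $\{1,\dots,n\}$, and let $S\subseteq A_n$ be the set of all $3$-cycles in $S_n$. Let $CAG_n=\mathrm{Cay}(A_n,S)$ be the complete alternating group graph, i.e. the simple undirected graph with vertex set $A_n$ whose edges are the pairs $\{\gamma, t\gamma\}$ with $\gamma\in A_n$ and $t\in S$. Let $\mathrm{Aut}(CAG_n)$ be its full group of graph automorphisms. Then $$|\mathrm{Aut}(CAG_n)|\le (n!)^2.$$ -/

import Mathlib

open scoped Nat Pointwise

/-- The Cayley graph `Cay(Γ, T)` of a group `Γ` with respect to a subset `T` such that `1 ∉ T` and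
`T⁻¹ = T`: the undirected graph with vertex set `Γ` and edges `{γ, t * γ}` for `γ ∈ Γ`, `t ∈ T`. -/
def cayleyGraph (Γ : Type*) [Group Γ] (T : Set Γ) (hone : (1 : Γ) ∉ T) (hinv : T⁻¹ = T) :
    SimpleGraph Γ where
  Adj u v := ∃ t ∈ T, v = t * u
  symm := ⟨by
    rintro u v ⟨t, ht, rfl⟩
    refine ⟨t⁻¹, ?_, by simp⟩
    rw [← hinv]
    simpa using ht⟩
  loopless := ⟨by
    rintro u ⟨t, ht, h⟩
    have : t = 1 := by simpa using h
    exact hone (this ▸ ht)⟩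

/-- The complete set of `3`-cycles of the symmetric group on `n` letters, as a subset of the
alternating group. -/
def threeCycles (n : ℕ) : Set (alternatingGroup (Fin n)) :=
  {τ | (τ : Equiv.Perm (Fin n)).IsThreeCycle}

theorem one_notMem_threeCycles (n : ℕ) : (1 : alternatingGroup (Fin n)) ∉ threeCycles n :=
  fun h => h.ne_one rfl

theorem inv_threeCycles (n : ℕ) : (threeCycles n)⁻¹ = threeCycles n := by
  ext τ
  simp [threeCycles]

/-- The complete alternating group graph `CAG_n = Cay(A_n, S)`, where `S` is the complete set of
`3`-cycles of the symmetric group on `n` letters. -/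
def CAG (n : ℕ) : SimpleGraph (alternatingGroup (Fin n)) :=
  cayleyGraph (alternatingGroup (Fin n)) (threeCycles n) (one_notMem_threeCycles n)
    (inv_threeCycles n)

/-- The graph automorphisms of `CAG n` form a finite set, so that `Nat.card` is its true order. -/
theorem finite_aut_CAG (n : ℕ) : Finite (CAG n ≃g CAG n) :=
  DFunLike.finite _

/-! Read a 3-cycle as a directed triangle with three arcs `x ⟶ s x`. Distinct 3-cycles are adjacent
exactly when they share an arc or are mutually inverse (`isThreeCycle_mul_inv_iff`). After a right
translation an automorphism fixes `1`, hence permutes the 3-cycles. It respects inversion and arc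
sharing, so it acts on arcs, and incidence of arcs forces this action to come from a permutation `σ`
of the points, up to reversal: on 3-cycles it is conjugation by `σ`, possibly after inversion
(`PreservesAdj.exists_conj`).

An automorphism fixing `1` and all 3-cycles is the identity: rigidity at one vertex passes to its
neighbours (`PreservesCayley.fixes_of_adj`), and 3-cycles generate the alternating group. Every
automorphism is thus given by `σ`, a choice of inversion and a translation, at most `n! * 2 * (n! /
2)` possibilities. -/

namespace ThreeCycle

open Equiv Equiv.Perm

/-! ### Three-cycles as directed triangles -/

/-- Two distinct permutations share an arc `x ⟶ y` with `x ≠ y`. -/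
def ShareArc {α : Type*} (s t : Perm α) : Prop := s ≠ t ∧ ∃ x, s x ≠ x ∧ t x = s x

variable {α : Type*} [Fintype α] [DecidableEq α]

theorem apply_three {s : Perm α} (hs : s.IsThreeCycle) (a : α) : s (s (s a)) = a := by
  have h : s ^ 3 = 1 := by rw [← hs.orderOf]; exact pow_orderOf_eq_one s
  have := congrArg (fun u : Perm α => u a) h
  simpa [pow_succ] using this

theorem apply_two_ne {s : Perm α} (hs : s.IsThreeCycle) {a : α} (ha : s a ≠ a) :
    s (s a) ≠ a := fun h => ha (by simpa [h] using apply_three hs a)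

theorem support_eq {s : Perm α} (hs : s.IsThreeCycle) {a : α} (ha : s a ≠ a) :
    s.support = {a, s a, s (s a)} := by
  symm
  apply Finset.eq_of_subset_of_card_le
  · intro x hx
    have := apply_two_ne hs ha
    have := apply_three hs a
    simp only [Finset.mem_insert, Finset.mem_singleton] at hx
    rw [mem_support]
    grind
  · have h2 := apply_two_ne hs ha
    rw [hs.card_support, Finset.card_eq_three.2
      ⟨a, s a, s (s a), ha.symm, h2.symm, fun h => ha (s.injective h).symm, rfl⟩]

theorem moved {s : Perm α} (hs : s.IsThreeCycle) {a x : α} (ha : s a ≠ a) (hx : s x ≠ x) :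
    x = a ∨ x = s a ∨ x = s (s a) := by
  have := support_eq hs ha
  have h : x ∈ s.support := mem_support.2 hx
  rw [this] at h
  simpa using h

theorem ext_of_agree {s t : Perm α} (hs : s.IsThreeCycle) (ht : t.IsThreeCycle) {a : α}
    (ha : s a ≠ a) (h₁ : t a = s a) (h₂ : t (s a) = s (s a)) : t = s := by
  ext x
  have := moved hs (x := x) ha
  have := moved ht (x := x) (a := a) (by rwa [h₁])
  have := apply_three hs a
  have := apply_three ht a
  by_cases hx : s x = x <;> by_cases hx' : t x = x <;> grind

theorem exists_threeCycle {a b c : α} (hab : a ≠ b) (hac : a ≠ c) (hbc : b ≠ c) :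
    ∃ s : Perm α, s.IsThreeCycle ∧ s a = b ∧ s b = c ∧ s c = a := by
  refine ⟨swap a c * swap a b, isThreeCycle_swap_mul_swap_same hac hab hbc.symm, ?_, ?_, ?_⟩
  · simp [swap_apply_of_ne_of_ne hab.symm hbc]
  · simp
  · simp [swap_apply_of_ne_of_ne hac.symm hbc.symm]

theorem eq_swap_mul_swap {s : Perm α} (hs : s.IsThreeCycle) {a : α} (ha : s a ≠ a) :
    s = swap a (s (s a)) * swap a (s a) := by
  have h2 := apply_two_ne hs ha
  have h3 : s (s a) ≠ s a := fun h => ha (s.injective h)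
  refine (ext_of_agree hs (isThreeCycle_swap_mul_swap_same h2.symm ha.symm h3) ha ?_ ?_).symm
  · simp [swap_apply_of_ne_of_ne ha h3.symm]
  · simp

/-- With common arc `a ⟶ b`, `s = (a c)(a b)` and `t = (a d)(a b)`, so `t * s⁻¹ = (a d)(a c)`. -/
theorem ShareArc.isThreeCycle {s t : Perm α} (hs : s.IsThreeCycle) (ht : t.IsThreeCycle)
    (h : ShareArc s t) : (t * s⁻¹).IsThreeCycle := by
  obtain ⟨hne, a, ha, hta⟩ := h
  have ha' : t a ≠ a := by rwa [hta]
  have h1 := eq_swap_mul_swap hs ha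
  have h2 := eq_swap_mul_swap ht ha'
  have h3 : t (t a) ≠ s (s a) := fun h => hne (ext_of_agree hs ht ha hta (by rw [← h, hta])).symm
  have : t * s⁻¹ = swap a (t (t a)) * swap a (s (s a)) := by
    rw [mul_inv_eq_iff_eq_mul]
    calc t = swap a (t (t a)) * swap a (s a) := by rw [← hta]; exact h2
      _ = swap a (t (t a)) * (swap a (s (s a)) * (swap a (s (s a)) * swap a (s a))) := by
        rw [swap_mul_self_mul]
      _ = _ := by rw [← h1, mul_assoc]
  rw [this]
  exact isThreeCycle_swap_mul_swap_same (apply_two_ne ht ha').symm (apply_two_ne hs ha).symm h3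

/-- Without a shared arc, `t * s⁻¹` moves every point of the support of `s`. By cardinality all
supports coincide, and three points carry only two 3-cycles. -/
theorem shareArc_or_eq_inv {s t : Perm α} (hs : s.IsThreeCycle) (ht : t.IsThreeCycle)
    (h : (t * s⁻¹).IsThreeCycle) : ShareArc s t ∨ t = s⁻¹ := by
  by_contra! hc
  obtain ⟨h1, h2⟩ := hc
  have hne : s ≠ t := by
    rintro rfl
    rw [mul_inv_cancel] at h
    exact h.ne_one rfl
  have h1' : ∀ x, s x ≠ x → t x ≠ s x := fun x hx hx' => h1 ⟨hne, x, hx, hx'⟩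
  have hsub : s.support ⊆ (t * s⁻¹).support := by
    intro x hx
    rw [mem_support] at hx ⊢
    have := h1' (s⁻¹ x) (by rw [← Perm.mul_apply, mul_inv_cancel, Perm.one_apply]; exact fun h => hx (Perm.inv_eq_iff_eq.1 h.symm).symm)
    simpa using this
  have hsupp := Finset.eq_of_subset_of_card_le hsub (by rw [h.card_support, hs.card_support])
  have ht_sub : ∀ x, t x ≠ x → s x ≠ x := by
    intro x hx hx'
    have : x ∉ (t * s⁻¹).support := by rw [← hsupp]; simpa using hx'
    rw [notMem_support, Perm.mul_apply, Perm.inv_eq_iff_eq.2 hx'.symm] at this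
    exact hx this
  have : s.support.Nonempty := by
    rw [← Finset.card_pos, hs.card_support]; norm_num
  obtain ⟨a, ha⟩ := this
  rw [mem_support] at ha
  have hsup : t.support = s.support := Finset.eq_of_subset_of_card_le
    (fun x hx => by rw [mem_support] at *; exact ht_sub x hx)
    (by rw [ht.card_support, hs.card_support])
  have hmv : ∀ x, t x ≠ x ↔ s x ≠ x := fun x => by
    rw [← mem_support, ← mem_support, hsup]
  apply h2
  have ha3 := apply_three hs a
  have ha2 := apply_two_ne hs ha
  have hta := (hmv a).2 ha
  have hb := moved hs ha ((hmv (t a)).1 fun h => hta (t.injective h))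
  have hta' : t a = s (s a) := by
    have := h1' a ha
    tauto
  have hinv : s⁻¹ a = s (s a) := by rw [Perm.inv_eq_iff_eq, ha3]
  have hinv' : s⁻¹ (s (s a)) = s a := by rw [Perm.inv_eq_iff_eq]
  have hk := h1' (s (s a)) (by rw [ha3]; exact ha2.symm)
  have hm := (hmv (s (s a))).2 (by rw [ha3]; exact ha2.symm)
  have hm' := (hmv (t (s (s a)))).1 fun h => hm (t.injective h)
  refine ext_of_agree hs.inv ht (a := a) (by rw [hinv]; exact ha2) (by rw [hta', hinv]) ?_
  rw [hinv, hinv']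
  have := moved hs ha hm'
  rw [ha3] at hk
  tauto

/-- Let `s`, `t` be `a ⟶ b ⟶ c`, `a ⟶ b ⟶ d`. Taking from each an arc other than `a ⟶ b` gives two
arcs into `a`, two out of `b`, or four points. -/
theorem common_arc {s t u : Perm α} (hs : s.IsThreeCycle) (ht : t.IsThreeCycle)
    (hu : u.IsThreeCycle) (hsu : ShareArc s u) (htu : ShareArc t u) (hst : s ≠ t) {a : α}
    (ha : s a ≠ a) (hta : t a = s a) : u a = s a := by
  have h2 := apply_two_ne hs ha
  have h3 := apply_three hs a
  have h2' := apply_two_ne ht (hta ▸ ha)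
  have h3' := apply_three ht a
  have h4 : t (t a) ≠ s (s a) := fun h => hst (ext_of_agree hs ht ha hta (by rw [← h, hta])).symm
  obtain ⟨hsu, x, hx, hux⟩ := hsu
  obtain ⟨htu, y, hy, huy⟩ := htu
  have hmx := moved hs ha hx
  have hmy := moved ht (hta ▸ ha) hy
  have hux' : u x ≠ x := by rwa [hux]
  have hm := moved hu hux' (x := y) (by rwa [huy])
  have hu3 := apply_three hu x
  have e := ext_of_agree hs hu (a := x) hx hux
  have hsu' : u ≠ s := Ne.symm hsu
  have e' := ext_of_agree ht hu (a := y) hy huy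
  have htu' : u ≠ t := Ne.symm htu
  clear hst hsu htu hs ht hu
  grind

theorem arc_unique {s t : Perm α} (hs : s.IsThreeCycle) (ht : t.IsThreeCycle) (hst : s ≠ t)
    {a b : α} (ha : s a ≠ a) (hta : t a = s a) (hb : s b ≠ b) (htb : t b = s b) : a = b := by
  have h3 := apply_three hs a
  have hmx := moved hs ha hb
  have := ext_of_agree hs ht ha hta
  have := ext_of_agree hs ht hb htb
  grind

/-- An arc of `s` and one of `s⁻¹` would confine `u` to the support of `s`. This is what tells
inverse pairs from arc-sharing pairs. -/
theorem not_shareArc_inv {s u : Perm α} (hs : s.IsThreeCycle) (hu : u.IsThreeCycle)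
    (hsu : ShareArc s u) (hsu' : ShareArc s⁻¹ u) : False := by
  obtain ⟨hne, x, hx, hux⟩ := hsu
  obtain ⟨hne', y, hy, huy⟩ := hsu'
  have h3 := apply_three hs x
  have h3' := apply_three hu x
  have h2 := apply_two_ne hs hx
  have h2' := apply_two_ne hu (hux ▸ hx)
  have e := ext_of_agree hs hu hx hux
  have hy' : s y ≠ y := fun h => hy (Perm.inv_eq_iff_eq.2 h.symm)
  have hz : s (u y) = y := by rw [huy]; simp
  have := moved hs hx hy'
  have := s.injective.eq_iff (a := u y) (b := s x)
  have := s.injective.eq_iff (a := u y) (b := x)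
  have := s.injective.eq_iff (a := u y) (b := s (s x))
  have := moved hu (hux ▸ hx) (x := y)
  grind

theorem exists_avoid (hα : 5 ≤ Fintype.card α) (a b c d : α) :
    ∃ e, e ≠ a ∧ e ≠ b ∧ e ≠ c ∧ e ≠ d := by
  have h : ({a, b, c, d} : Finset α).card < (Finset.univ : Finset α).card :=
    lt_of_le_of_lt Finset.card_le_four (by rw [Finset.card_univ]; omega)
  obtain ⟨e, -, he⟩ := Finset.exists_mem_notMem_of_card_lt_card h
  exact ⟨e, by simpa using he⟩

theorem exists_threeCycle_avoid (hα : 5 ≤ Fintype.card α) {a b : α} (hab : a ≠ b) (s t : Perm α) :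
    ∃ u : Perm α, u.IsThreeCycle ∧ u a = b ∧ u ≠ s ∧ u ≠ t := by
  -- The third point has four values to avoid, hence at least five points.
  obtain ⟨c, hca, hcb, hcs, hct⟩ := exists_avoid hα a b (s b) (t b)
  obtain ⟨u, hu, hua, hub, -⟩ := exists_threeCycle hab hca.symm hcb.symm
  exact ⟨u, hu, hua, fun h => hcs (by rw [← hub, h]), fun h => hct (by rw [← hub, h])⟩

theorem isThreeCycle_mul_inv_iff {s t : Perm α} (hs : s.IsThreeCycle) (ht : t.IsThreeCycle) :
    (t * s⁻¹).IsThreeCycle ↔ ShareArc s t ∨ t = s⁻¹ := by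
  refine ⟨shareArc_or_eq_inv hs ht, ?_⟩
  rintro (h | rfl)
  · exact h.isThreeCycle hs ht
  · have : s⁻¹ * s⁻¹ = s := by
      ext x
      have := apply_three hs x
      rw [Perm.mul_apply, Perm.inv_eq_iff_eq, Perm.inv_eq_iff_eq, this]
    rwa [this]

/-! ### The induced action on arcs -/

/-- The adjacency of the graph induced on the `3`-cycles by the Cayley graph is preserved. -/
def PreservesAdj (f : {s : Perm α // s.IsThreeCycle} ≃ {s : Perm α // s.IsThreeCycle}) : Prop :=
  ∀ s t : {s : Perm α // s.IsThreeCycle}, ((t : Perm α) * (s : Perm α)⁻¹).IsThreeCycle ↔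
    ((f t : Perm α) * (f s : Perm α)⁻¹).IsThreeCycle

variable {f : {s : Perm α // s.IsThreeCycle} ≃ {s : Perm α // s.IsThreeCycle}}

theorem PreservesAdj.symm (h : PreservesAdj f) : PreservesAdj f.symm := fun s t => by
  have := h (f.symm s) (f.symm t)
  simp only [apply_symm_apply] at this
  exact this.symm

/-- If the images shared an arc, a third 3-cycle through it would pull back to one sharing arcs with
both `s` and `s⁻¹`. -/
theorem PreservesAdj.map_inv (hα : 5 ≤ Fintype.card α) (h : PreservesAdj f)
    (s : {s : Perm α // s.IsThreeCycle}) : (f ⟨(s : Perm α)⁻¹, s.2.inv⟩ : Perm α) = (f s : Perm α)⁻¹ := by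
  have h1 := (h s ⟨(s : Perm α)⁻¹, s.2.inv⟩).1 ((isThreeCycle_mul_inv_iff s.2 s.2.inv).2 (Or.inr rfl))
  rcases (isThreeCycle_mul_inv_iff (f s).2 (f _).2).1 h1 with h2 | h2
  swap
  · exact h2
  exfalso
  obtain ⟨-, x, hx, hx'⟩ := h2
  obtain ⟨u, hu, hux, hus, hus'⟩ := exists_threeCycle_avoid hα hx.symm (f s)
    (f ⟨(s : Perm α)⁻¹, s.2.inv⟩ : Perm α)
  obtain ⟨v, hv⟩ := f.surjective ⟨u, hu⟩
  have hv' : (f v : Perm α) = u := by rw [hv]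
  have a1 : ((v : Perm α) * (s : Perm α)⁻¹).IsThreeCycle := by
    rw [h, isThreeCycle_mul_inv_iff (f s).2 (f v).2, hv']
    exact Or.inl ⟨hus.symm, x, hx, hux⟩
  have a2 : ((v : Perm α) * (s : Perm α)⁻¹⁻¹).IsThreeCycle := by
    rw [h ⟨(s : Perm α)⁻¹, s.2.inv⟩ v, isThreeCycle_mul_inv_iff (f _).2 (f v).2, hv']
    exact Or.inl ⟨hus'.symm, x, by rwa [hx'], by rw [hux, hx']⟩
  rw [isThreeCycle_mul_inv_iff s.2 v.2] at a1
  rw [isThreeCycle_mul_inv_iff s.2.inv v.2] at a2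
  have n1 : (v : Perm α) ≠ (s : Perm α)⁻¹ := by
    intro e
    apply hus'
    rw [← hv']
    exact congrArg (fun w => (f w : Perm α)) (Subtype.ext e)
  have n2 : (v : Perm α) ≠ (s : Perm α)⁻¹⁻¹ := by
    intro e
    apply hus
    rw [← hv']
    exact congrArg (fun w => (f w : Perm α)) (Subtype.ext (by rw [e, inv_inv]))
  exact not_shareArc_inv s.2 v.2 (a1.resolve_right n1) (a2.resolve_right n2)

theorem ne_inv_of_shareArc {s t : Perm α} (hs : s.IsThreeCycle) (h : ShareArc s t) : t ≠ s⁻¹ := by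
  rintro rfl
  obtain ⟨-, x, hx, hx'⟩ := h
  rw [Perm.inv_eq_iff_eq] at hx'
  exact apply_two_ne hs hx hx'.symm

theorem PreservesAdj.shareArc (hα : 5 ≤ Fintype.card α) (h : PreservesAdj f)
    {s t : {s : Perm α // s.IsThreeCycle}} (hst : ShareArc (s : Perm α) t) :
    ShareArc (f s : Perm α) (f t) := by
  have h1 := (h s t).1 ((isThreeCycle_mul_inv_iff s.2 t.2).2 (Or.inl hst))
  refine ((isThreeCycle_mul_inv_iff (f s).2 (f t).2).1 h1).resolve_right fun h2 => ?_
  rw [← h.map_inv hα, Subtype.coe_inj, f.apply_eq_iff_eq] at h2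
  exact ne_inv_of_shareArc s.2 hst (congrArg Subtype.val h2)

theorem PreservesAdj.exists_arc (hα : 5 ≤ Fintype.card α) (h : PreservesAdj f) {a b : α}
    (hab : a ≠ b) : ∃ a' b', a' ≠ b' ∧
      ∀ s : {s : Perm α // s.IsThreeCycle}, (s : Perm α) a = b → (f s : Perm α) a' = b' := by
  obtain ⟨u, hu, hua, -, -⟩ := exists_threeCycle_avoid hα hab 1 1
  obtain ⟨v, hv, hva, hvu, -⟩ := exists_threeCycle_avoid hα hab u u
  have share : ∀ {s t : {s : Perm α // s.IsThreeCycle}}, s ≠ t → (s : Perm α) a = b →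
      (t : Perm α) a = b → ShareArc (f s : Perm α) (f t) := fun hne h1 h2 =>
    h.shareArc hα ⟨fun e => hne (Subtype.ext e), a, by rw [h1]; exact hab.symm, by rw [h1, h2]⟩
  have huv : (⟨u, hu⟩ : {s : Perm α // s.IsThreeCycle}) ≠ ⟨v, hv⟩ :=
    fun e => hvu (congrArg Subtype.val e).symm
  obtain ⟨hne, x, hx, hx'⟩ := share huv hua hva
  refine ⟨x, (f ⟨u, hu⟩ : Perm α) x, hx.symm, fun s hs => ?_⟩
  by_cases h1 : s = ⟨u, hu⟩
  · rw [h1]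
  by_cases h2 : s = ⟨v, hv⟩
  · rw [h2, hx']
  exact common_arc (f _).2 (f _).2 (f s).2 (share (Ne.symm h1) hua hs) (share (Ne.symm h2) hva hs)
    hne hx hx'

/-- Two distinct 3-cycles through `a ⟶ b` have no other arc in common. -/
theorem arc_eq (hα : 5 ≤ Fintype.card α) {a b c d : α} (hab : a ≠ b)
    (h : ∀ s : Perm α, s.IsThreeCycle → s a = b → s c = d) (hcd : c ≠ d) : a = c ∧ b = d := by
  obtain ⟨u, hu, hua, -, -⟩ := exists_threeCycle_avoid hα hab 1 1
  obtain ⟨v, hv, hva, hvu, -⟩ := exists_threeCycle_avoid hα hab u u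
  have huc := h u hu hua
  have hvc := h v hv hva
  have : a = c := arc_unique hu hv hvu.symm (by rw [hua]; exact hab.symm) (by rw [hua, hva])
    (by rw [huc]; exact hcd.symm) (by rw [huc, hvc])
  subst this
  exact ⟨rfl, by rw [← hua, huc]⟩

theorem PreservesAdj.exists_arc_iff (hα : 5 ≤ Fintype.card α) (h : PreservesAdj f) {a b : α}
    (hab : a ≠ b) : ∃ a' b', a' ≠ b' ∧
      ∀ s : {s : Perm α // s.IsThreeCycle}, (s : Perm α) a = b ↔ (f s : Perm α) a' = b' := by
  obtain ⟨a', b', hab', h1⟩ := h.exists_arc hα hab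
  obtain ⟨c, d, hcd, h2⟩ := h.symm.exists_arc hα hab'
  obtain ⟨rfl, rfl⟩ := arc_eq hα hab (fun s hs e => by
    simpa using h2 _ (h1 ⟨s, hs⟩ e)) hcd
  exact ⟨a', b', hab', fun s => ⟨h1 s, fun e => by simpa using h2 _ e⟩⟩

/-- A map of the arcs `a ⟶ b` of the form `(p a b, p b a)` that describes `f`. -/
theorem PreservesAdj.exists_arcMap (hα : 5 ≤ Fintype.card α) (h : PreservesAdj f) :
    ∃ p : α → α → α, (∀ a b, a ≠ b → p a b ≠ p b a) ∧ ∀ a b, a ≠ b →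
      ∀ s : {s : Perm α // s.IsThreeCycle},
        (s : Perm α) a = b ↔ (f s : Perm α) (p a b) = p b a := by
  have := fun a b (hab : a ≠ b) => h.exists_arc_iff hα hab
  choose! p q hpq hiff using this
  -- Since `f` commutes with inversion, reversed arcs have reversed images.
  have hq : ∀ a b, a ≠ b → p b a = q a b := by
    intro a b hab
    refine (arc_eq hα (hpq b a hab.symm) (fun s hs e => ?_) (hpq a b hab).symm).1
    have e1 : (f (f.symm ⟨s, hs⟩) : Perm α) (p b a) = q b a := by simpa using e
    rw [← hiff b a hab.symm] at e1
    have e2 := (hiff a b hab ⟨(f.symm ⟨s, hs⟩ : Perm α)⁻¹, (f.symm ⟨s, hs⟩).2.inv⟩).1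
      (Perm.inv_eq_iff_eq.2 e1.symm)
    rw [h.map_inv hα, Perm.inv_eq_iff_eq] at e2
    simpa using e2.symm
  refine ⟨p, fun a b hab => hq a b hab ▸ hpq a b hab, fun a b hab s => ?_⟩
  rw [hq a b hab]
  exact hiff a b hab s

/-- Two arcs lie on a common `3`-cycle precisely if they are equal or one continues the other. -/
theorem exists_both_arcs_iff (hα : 5 ≤ Fintype.card α) {a b c d : α} (hab : a ≠ b) (hcd : c ≠ d) :
    (∃ s : {s : Perm α // s.IsThreeCycle}, (s : Perm α) a = b ∧ (s : Perm α) c = d) ↔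
      (a = c ∧ b = d) ∨ (b = c ∧ a ≠ d) ∨ (a = d ∧ b ≠ c) := by
  constructor
  · rintro ⟨⟨s, hs⟩, h1, h2⟩
    simp only at h1 h2
    have h3 := apply_three hs a
    have h4 := apply_two_ne hs (a := a) (by rw [h1]; exact hab.symm)
    have := moved hs (a := a) (x := c) (by rw [h1]; exact hab.symm) (by rw [h2]; exact hcd.symm)
    have := s.injective.eq_iff (a := a) (b := b)
    grind
  · rintro (⟨rfl, rfl⟩ | ⟨rfl, had⟩ | ⟨rfl, hbc⟩)
    · obtain ⟨u, hu, hua, -, -⟩ := exists_threeCycle_avoid hα hab 1 1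
      exact ⟨⟨u, hu⟩, hua, hua⟩
    · obtain ⟨u, hu, h1, h2, -⟩ := exists_threeCycle hab had hcd
      exact ⟨⟨u, hu⟩, h1, h2⟩
    · obtain ⟨u, hu, h1, h2, -⟩ := exists_threeCycle hcd hbc.symm hab
      exact ⟨⟨u, hu⟩, h2, h1⟩

theorem PreservesAdj.exists_parallel_arcMap (hα : 5 ≤ Fintype.card α) (h : PreservesAdj f) :
    ∃ p : α → α → α, (∀ a b, a ≠ b → p a b ≠ p b a) ∧
      (∀ a b, a ≠ b → ∀ s : {s : Perm α // s.IsThreeCycle},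
        (s : Perm α) a = b ↔ (f s : Perm α) (p a b) = p b a) ∧
      (∀ a b c d, a ≠ b → c ≠ d → p a b = p c d → p b a = p d c → a = c ∧ b = d) ∧
      ∀ a b c d, a ≠ b → c ≠ d → ((a = c ∨ b = d) ↔ (p a b = p c d ∨ p b a = p d c)) := by
  obtain ⟨p, hp, hiff⟩ := h.exists_arcMap hα
  have hinj : ∀ a b c d, a ≠ b → c ≠ d → p a b = p c d → p b a = p d c → a = c ∧ b = d := by
    intro a b c d hab hcd h1 h2
    refine arc_eq hα hab (fun s hs e => ?_) hcd
    have := (hiff a b hab ⟨s, hs⟩).1 e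
    rw [h1, h2] at this
    exact (hiff c d hcd ⟨s, hs⟩).2 this
  refine ⟨p, hp, hiff, hinj, fun a b c d hab hcd => ?_⟩
  -- Reversing the first arc turns head-to-tail incidence into a common source or target.
  have key : (∃ s : {s : Perm α // s.IsThreeCycle}, (s : Perm α) b = a ∧ (s : Perm α) c = d) ↔
      ∃ s : {s : Perm α // s.IsThreeCycle},
        (s : Perm α) (p b a) = p a b ∧ (s : Perm α) (p c d) = p d c := by
    simp only [hiff b a hab.symm, hiff c d hcd]
    exact (f.surjective.exists (p := fun s => (s : Perm α) (p b a) = p a b ∧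
      (s : Perm α) (p c d) = p d c)).symm
  rw [exists_both_arcs_iff hα hab.symm hcd,
    exists_both_arcs_iff hα (hp a b hab).symm (hp c d hcd)] at key
  have i1 := hinj a b c d hab hcd
  have i2 := hinj a b d c hab hcd.symm
  grind

/-! ### From arcs to points -/

/-- A map of arcs that preserves having a common source or a common target comes from a
permutation of the points, up to reversal. -/
theorem exists_perm_of_parallel (hα : 5 ≤ Fintype.card α) {p : α → α → α}
    (hinj : ∀ a b c d, a ≠ b → c ≠ d → p a b = p c d → p b a = p d c → a = c ∧ b = d)
    (hpar : ∀ a b c d, a ≠ b → c ≠ d → ((a = c ∨ b = d) ↔ (p a b = p c d ∨ p b a = p d c))) :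
    ∃ σ : Perm α, (∀ a b, a ≠ b → p a b = σ a) ∨ (∀ a b, a ≠ b → p b a = σ a) := by
  have hrow : ∀ a b c, a ≠ b → a ≠ c → p a b = p a c ∨ p b a = p c a := fun a b c hab hac =>
    (hpar a b a c hab hac).1 (Or.inl rfl)
  have hinj' : ∀ a b c, a ≠ b → a ≠ c → p a b = p a c → p b a = p c a → b = c :=
    fun a b c hab hac h1 h2 => (hinj a b a c hab hac h1 h2).2
  -- View arcs as grid cells (source, target). The images of the arcs out of `a` are distinct cells,
  -- pairwise in a common row or column; three such cells cannot form an L, so all lie on one line.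
  have hline : ∀ a, (∀ b c, a ≠ b → a ≠ c → p a b = p a c) ∨
      ∀ b c, a ≠ b → a ≠ c → p b a = p c a := by
    intro a
    by_contra! hc
    obtain ⟨⟨b, c, hb, hc, h1⟩, d, e, hd, he, h2⟩ := hc
    have r := hrow a
    have i := hinj' a
    have := r b c hb hc
    have := r b d hb hd
    have := r b e hb he
    have := r c d hc hd
    have := r c e hc he
    have := r d e hd he
    have := i b c hb hc
    have := i b d hb hd
    have := i b e hb he
    have := i c d hc hd
    have := i c e hc he
    have := i d e hd he
    clear r i hrow hinj' hinj hpar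
    grind
  -- If `a` keeps direction and `b` reverses it, the images of `a ⟶ x` and `y ⟶ b` share their
  -- source with that of `a ⟶ b`, although the two arcs have neither end in common.
  have hmixed : ∀ a b, (∀ x y, a ≠ x → a ≠ y → p a x = p a y) →
      (∀ x y, b ≠ x → b ≠ y → p x b = p y b) → False := by
    intro a b ha hb
    have hne : a ≠ b := by
      rintro rfl
      obtain ⟨c, hc, -⟩ := exists_avoid hα a a a a
      obtain ⟨d, hd, hdc, -⟩ := exists_avoid hα a c a a
      exact hdc (hinj' a d c hd.symm hc.symm (ha _ _ hd.symm hc.symm) (hb _ _ hd.symm hc.symm))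
    obtain ⟨x, hxa, hxb, -⟩ := exists_avoid hα a b a a
    obtain ⟨y, hya, hyb, hyx, -⟩ := exists_avoid hα a b x a
    have h1 : p a x = p y b := by rw [ha x b hxa.symm hne, hb a y hne.symm hyb.symm]
    rcases (hpar a x y b hxa.symm hyb).2 (Or.inl h1) with h | h
    · exact hya h.symm
    · exact hxb h
  obtain ⟨g, hg⟩ : ∃ g : α → α, ∀ a, a ≠ g a :=
    ⟨fun a => (exists_avoid hα a a a a).choose, fun a =>
      (exists_avoid hα a a a a).choose_spec.1.symm⟩
  by_cases hR : ∀ a b c, a ≠ b → a ≠ c → p a b = p a c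
  · have hI : Function.Injective fun a => p a (g a) := by
      intro a c hac
      by_contra hne
      obtain ⟨x, hxa, hxc, -⟩ := exists_avoid hα a c a a
      obtain ⟨y, hya, hyc, hyx, -⟩ := exists_avoid hα a c x a
      have := (hpar a x c y hxa.symm hyc.symm).2 (Or.inl (by
        rw [hR a x (g a) hxa.symm (hg a), hR c y (g c) hyc.symm (hg c)]; exact hac))
      exact this.elim hne hyx.symm
    exact ⟨Equiv.ofBijective _ (Finite.injective_iff_bijective.1 hI),
      Or.inl fun a b hab => hR a b (g a) hab (hg a)⟩
  · push Not at hR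
    obtain ⟨a₀, b₀, c₀, hb₀, hc₀, hne₀⟩ := hR
    have h₀ := (hline a₀).resolve_left fun h => hne₀ (h _ _ hb₀ hc₀)
    have hC : ∀ a b c, a ≠ b → a ≠ c → p b a = p c a := fun a =>
      (hline a).resolve_left fun h => hmixed a a₀ h h₀
    have hI : Function.Injective fun a => p (g a) a := by
      intro a c hac
      by_contra hne
      obtain ⟨x, hxa, hxc, -⟩ := exists_avoid hα a c a a
      obtain ⟨y, hya, hyc, hyx, -⟩ := exists_avoid hα a c x a
      have := (hpar a x c y hxa.symm hyc.symm).2 (Or.inr (by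
        rw [hC a x (g a) hxa.symm (hg a), hC c y (g c) hyc.symm (hg c)]; exact hac))
      exact this.elim hne hyx.symm
    exact ⟨Equiv.ofBijective _ (Finite.injective_iff_bijective.1 hI),
      Or.inr fun a b hab => hC a b (g a) hab (hg a)⟩

omit [Fintype α] [DecidableEq α] in
theorem inv_apply_apply (σ : Perm α) (a : α) : σ⁻¹ (σ a) = a := Perm.inv_eq_iff_eq.2 rfl

theorem eq_of_forall_moved {s t : Perm α} (hs : s.IsThreeCycle) (ht : t.IsThreeCycle)
    (h : ∀ x, s x ≠ x → t x = s x) : t = s := by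
  have : s.support.Nonempty := by
    rw [← Finset.card_pos, hs.card_support]; norm_num
  obtain ⟨a, ha⟩ := this
  rw [mem_support] at ha
  exact ext_of_agree hs ht ha (h a ha) (h _ fun e => ha (s.injective e))

theorem isThreeCycle_conj {s : Perm α} (hs : s.IsThreeCycle) (σ : Perm α) :
    (σ * s * σ⁻¹).IsThreeCycle := by
  rw [IsThreeCycle, cycleType_conj]
  exact hs

/-- A permutation of the `3`-cycles preserving adjacency is conjugation by a permutation, possibly
followed by inversion. -/
theorem PreservesAdj.exists_conj (hα : 5 ≤ Fintype.card α) (h : PreservesAdj f) :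
    ∃ σ : Perm α, (∀ s, (f s : Perm α) = σ * s * σ⁻¹) ∨
      ∀ s, (f s : Perm α) = σ * (s : Perm α)⁻¹ * σ⁻¹ := by
  obtain ⟨p, hp, hiff, hinj, hpar⟩ := h.exists_parallel_arcMap hα
  obtain ⟨σ, hσ | hσ⟩ := exists_perm_of_parallel hα hinj hpar
  · refine ⟨σ, Or.inl fun s => eq_of_forall_moved (isThreeCycle_conj s.2 σ) (f s).2 fun x hx => ?_⟩
    obtain ⟨a, rfl⟩ := σ.surjective x
    simp only [Perm.mul_apply, inv_apply_apply, ne_eq, σ.apply_eq_iff_eq] at hx ⊢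
    have := (hiff a _ (Ne.symm hx) s).1 rfl
    rwa [hσ a _ (Ne.symm hx), hσ _ a hx] at this
  · refine ⟨σ, Or.inr fun s =>
      eq_of_forall_moved (isThreeCycle_conj s.2.inv σ) (f s).2 fun x hx => ?_⟩
    obtain ⟨a, rfl⟩ := σ.surjective x
    simp only [Perm.mul_apply, inv_apply_apply, ne_eq, σ.apply_eq_iff_eq] at hx ⊢
    have := (hiff _ a hx s).1 (by rw [← Perm.mul_apply, mul_inv_cancel, Perm.one_apply])
    rwa [hσ a _ (Ne.symm hx), hσ _ a hx] at this

/-- `σ` commutes with all 3-cycles through `a ⟶ b`. Two of them, with third points `c` and `d`, give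
`σ a ∈ {a, b}`; `σ a = b` would give `σ b = c` and `σ b = d`. Any other point is the third point of
such a 3-cycle. -/
theorem eq_one_of_conj_eq (hα : 5 ≤ Fintype.card α) {a b : α} (hab : a ≠ b) {σ : Perm α}
    (h : ∀ u : Perm α, u.IsThreeCycle → u a = b → σ * u * σ⁻¹ = u) : σ = 1 := by
  have hc : ∀ u : Perm α, u.IsThreeCycle → u a = b → ∀ x, σ (u x) = u (σ x) := by
    intro u hu hua x
    have := mul_inv_eq_iff_eq_mul.1 (h u hu hua)
    exact congrArg (fun v : Perm α => v x) this
  obtain ⟨c, hca, hcb, -⟩ := exists_avoid hα a b a a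
  obtain ⟨d, hda, hdb, hdc, -⟩ := exists_avoid hα a b c a
  obtain ⟨u, hu, hua, hub, huc⟩ := exists_threeCycle hab hca.symm hcb.symm
  obtain ⟨v, hv, hva, hvb, hvd⟩ := exists_threeCycle hab hda.symm hdb.symm
  have hσa : σ a = a := by
    have c1 := hc u hu hua
    have c2 := hc v hv hva
    have n1 : u (σ a) ≠ σ a := by rw [← c1, hua]; exact fun h => hab (σ.injective h).symm
    have n2 : v (σ a) ≠ σ a := by rw [← c2, hva]; exact fun h => hab (σ.injective h).symm
    have m1 := moved hu (a := a) (by rw [hua]; exact hab.symm) n1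
    have m2 := moved hv (a := a) (by rw [hva]; exact hab.symm) n2
    have d1 := c1 a
    have d2 := c2 a
    grind
  have hσb : σ b = b := by rw [← hua, hc u hu hua, hσa]
  ext x
  by_cases hxa : x = a
  · rw [hxa, hσa, Perm.one_apply]
  by_cases hxb : x = b
  · rw [hxb, hσb, Perm.one_apply]
  obtain ⟨w, hw, hwa, hwb, -⟩ := exists_threeCycle hab (Ne.symm hxa) (Ne.symm hxb)
  rw [← hwb, hc w hw hwa, hσb, Perm.one_apply]

theorem apply_of_conj_inv_eq (hα : 5 ≤ Fintype.card α) {a b : α} (hab : a ≠ b) {σ : Perm α}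
    (h : ∀ u : Perm α, u.IsThreeCycle → u a = b → σ * u⁻¹ * σ⁻¹ = u) : σ a = b ∧ σ b = a := by
  have hc : ∀ u : Perm α, u.IsThreeCycle → u a = b → ∀ x, σ x = u (σ (u x)) := by
    intro u hu hua x
    have := mul_inv_eq_iff_eq_mul.1 (h u hu hua)
    have := congrArg (fun v : Perm α => v (u x)) this
    simpa [inv_apply_apply] using this
  obtain ⟨c, hca, hcb, -⟩ := exists_avoid hα a b a a
  obtain ⟨d, hda, hdb, hdc, -⟩ := exists_avoid hα a b c a
  obtain ⟨u, hu, hua, hub, huc⟩ := exists_threeCycle hab hca.symm hcb.symm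
  obtain ⟨v, hv, hva, hvb, hvd⟩ := exists_threeCycle hab hda.symm hdb.symm
  have c1 := hc u hu hua a
  have c2 := hc v hv hva a
  rw [hua] at c1
  rw [hva] at c2
  have hne : σ a ≠ σ b := fun h => hab (σ.injective h)
  have m1 := moved hu (a := a) (by rw [hua]; exact hab.symm) (x := σ b) (by rwa [← c1])
  have m2 := moved hv (a := a) (by rw [hva]; exact hab.symm) (x := σ b) (by rwa [← c2])
  rw [hua, hub] at m1
  rw [hva, hvb] at m2
  have hσb : σ b = a := by
    rcases m1 with m1 | m1 | m1
    · exact m1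
    · rw [m1, hub] at c1
      rw [m1, hvb] at c2
      exact absurd (c2.symm.trans c1) hdc
    · rw [m1] at m2
      exact absurd m2 (by simp [hca, hcb, hdc.symm])
  exact ⟨by rw [c1, hσb, hua], hσb⟩

/-! ### Automorphisms of the Cayley graph -/

/-- The map preserves adjacency in the Cayley graph of the alternating group with respect to all
`3`-cycles. -/
def PreservesCayley (F : alternatingGroup α ≃ alternatingGroup α) : Prop :=
  ∀ u v, ((v * u⁻¹ : alternatingGroup α) : Perm α).IsThreeCycle ↔
    ((F v * (F u)⁻¹ : alternatingGroup α) : Perm α).IsThreeCycle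

theorem PreservesCayley.trans {F G : alternatingGroup α ≃ alternatingGroup α}
    (hF : PreservesCayley F) (hG : PreservesCayley G) : PreservesCayley (F.trans G) :=
  fun u v => (hF u v).trans (hG (F u) (F v))

theorem PreservesCayley.symm {F : alternatingGroup α ≃ alternatingGroup α}
    (hF : PreservesCayley F) : PreservesCayley F.symm := fun u v => by
  have := hF (F.symm u) (F.symm v)
  simp only [apply_symm_apply] at this
  exact this.symm

theorem preservesCayley_mulRight (g : alternatingGroup α) :
    PreservesCayley (Equiv.mulRight g) := fun u v => by
  simp [mul_assoc]

theorem preservesCayley_conj (σ : Perm α) :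
    PreservesCayley (MulAut.conjNormal σ : MulAut (alternatingGroup α)).toEquiv := fun u v => by
  change _ ↔ ((MulAut.conjNormal σ v * (MulAut.conjNormal σ u)⁻¹ : alternatingGroup α) :
    Perm α).IsThreeCycle
  rw [← map_inv, ← map_mul, MulAut.conjNormal_apply, IsThreeCycle, IsThreeCycle, cycleType_conj]

theorem preservesCayley_inv : PreservesCayley (Equiv.inv (alternatingGroup α)) := fun u v => by
  have h : ((v⁻¹ * u⁻¹⁻¹ : alternatingGroup α) : Perm α) =
      (v : Perm α)⁻¹ * ((v : Perm α) * (u : Perm α)⁻¹)⁻¹ * (v : Perm α)⁻¹⁻¹ := by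
    simp [mul_assoc]
  change _ ↔ ((v⁻¹ * u⁻¹⁻¹ : alternatingGroup α) : Perm α).IsThreeCycle
  rw [h, IsThreeCycle, IsThreeCycle, cycleType_conj, cycleType_inv]
  rfl

theorem PreservesCayley.exists_conj (hα : 5 ≤ Fintype.card α)
    {F : alternatingGroup α ≃ alternatingGroup α} (hF : PreservesCayley F) (h1 : F 1 = 1) :
    ∃ σ : Perm α,
      (∀ s : alternatingGroup α, (s : Perm α).IsThreeCycle → (F s : Perm α) = σ * s * σ⁻¹) ∨
      ∀ s : alternatingGroup α, (s : Perm α).IsThreeCycle →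
        (F s : Perm α) = σ * (s : Perm α)⁻¹ * σ⁻¹ := by
  have h3 : ∀ s : alternatingGroup α, (s : Perm α).IsThreeCycle → (F s : Perm α).IsThreeCycle :=
    fun s hs => by simpa [h1] using (hF 1 s).1 (by simpa using hs)
  let g : {s : Perm α // s.IsThreeCycle} → {s : Perm α // s.IsThreeCycle} := fun s =>
    ⟨F ⟨s, s.2.mem_alternatingGroup⟩, h3 _ s.2⟩
  have hg : Function.Injective g := fun s t hst => by
    have h4 : (F ⟨s, s.2.mem_alternatingGroup⟩ : Perm α) = F ⟨t, t.2.mem_alternatingGroup⟩ :=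
      congrArg (fun u : {s : Perm α // s.IsThreeCycle} => (u : Perm α)) hst
    have := F.injective (Subtype.ext h4)
    exact Subtype.ext (congrArg (fun u : alternatingGroup α => (u : Perm α)) this)
  have hpres : PreservesAdj (Equiv.ofBijective g (Finite.injective_iff_bijective.1 hg)) :=
    fun s t => hF ⟨s, s.2.mem_alternatingGroup⟩ ⟨t, t.2.mem_alternatingGroup⟩
  obtain ⟨σ, h | h⟩ := hpres.exists_conj hα
  · exact ⟨σ, Or.inl fun s hs => h ⟨s, hs⟩⟩
  · exact ⟨σ, Or.inr fun s hs => h ⟨s, hs⟩⟩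

/-- The 3-cycles through one arc of `s` already force `σ = 1` in the conjugation case. In the
inversion case `σ` would swap the ends of two consecutive arcs of `s`, which is impossible. -/
theorem PreservesCayley.fixes_of_adj (hα : 5 ≤ Fintype.card α)
    {F : alternatingGroup α ≃ alternatingGroup α} (hF : PreservesCayley F) (h1 : F 1 = 1)
    {s : alternatingGroup α} (hs : (s : Perm α).IsThreeCycle) (hFs : F s = s)
    (hadj : ∀ t : alternatingGroup α, (t : Perm α).IsThreeCycle →
      ((t * s⁻¹ : alternatingGroup α) : Perm α).IsThreeCycle → F t = t)
    (t : alternatingGroup α) (ht : (t : Perm α).IsThreeCycle) : F t = t := by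
  have hfix : ∀ x, (s : Perm α) x ≠ x → ∀ u : Perm α, ∀ hu : u.IsThreeCycle,
      u x = (s : Perm α) x → (F ⟨u, hu.mem_alternatingGroup⟩ : Perm α) = u := by
    intro x hx u hu hux
    by_cases hus : (s : Perm α) = u
    · subst hus
      exact congrArg Subtype.val hFs
    · exact congrArg Subtype.val (hadj ⟨u, hu.mem_alternatingGroup⟩ hu
        (ShareArc.isThreeCycle hs hu ⟨hus, x, hx, hux⟩))
  obtain ⟨a, ha⟩ : (s : Perm α).support.Nonempty := by
    rw [← Finset.card_pos, hs.card_support]; norm_num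
  rw [mem_support] at ha
  have hb : (s : Perm α) ((s : Perm α) a) ≠ (s : Perm α) a := fun e =>
    ha ((s : Perm α).injective e)
  obtain ⟨σ, h | h⟩ := hF.exists_conj hα h1
  · have : σ = 1 := eq_one_of_conj_eq hα ha.symm fun u hu hua => by
      rw [← h ⟨u, hu.mem_alternatingGroup⟩ hu, hfix a ha u hu hua]
    apply Subtype.ext
    rw [h t ht, this]
    simp
  · have e1 := apply_of_conj_inv_eq hα ha.symm (σ := σ) fun u hu hua => by
      rw [← h ⟨u, hu.mem_alternatingGroup⟩ hu, hfix _ ha u hu hua]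
    have e2 := apply_of_conj_inv_eq hα hb.symm (σ := σ) fun u hu hua => by
      rw [← h ⟨u, hu.mem_alternatingGroup⟩ hu, hfix _ hb u hu hua]
    exact absurd (e2.1.symm.trans e1.2) (apply_two_ne hs ha)

theorem PreservesCayley.eq_refl (hα : 5 ≤ Fintype.card α)
    {F : alternatingGroup α ≃ alternatingGroup α} (hF : PreservesCayley F) (h1 : F 1 = 1)
    (hfix : ∀ t : alternatingGroup α, (t : Perm α).IsThreeCycle → F t = t)
    (x : alternatingGroup α) : F x = x := by
  have step : ∀ x t₀ : alternatingGroup α, (t₀ : Perm α).IsThreeCycle →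
      (F x = x ∧ ∀ t : alternatingGroup α, (t : Perm α).IsThreeCycle → F (t * x) = t * x) →
      F (t₀ * x) = t₀ * x ∧
        ∀ t : alternatingGroup α, (t : Perm α).IsThreeCycle → F (t * (t₀ * x)) = t * (t₀ * x) := by
    rintro x t₀ ht₀ ⟨hx, hxt⟩
    have hx₁ := hxt t₀ ht₀
    refine ⟨hx₁, fun t ht => ?_⟩
    -- Recentre at `t₀ * x`: the old centre `x` becomes the neighbour `t₀⁻¹` of `1`, and the common
    -- neighbours of `1` and `t₀⁻¹` are already fixed.
    have hG := ((preservesCayley_mulRight (t₀ * x)).trans hF).trans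
      (preservesCayley_mulRight (t₀ * x)⁻¹)
    have := hG.fixes_of_adj hα (by simp [hx₁]) (s := t₀⁻¹) (by simpa using ht₀)
      (by simp [hx]) (fun u hu hut => ?_) t ht
    · simp only [Equiv.trans_apply, Equiv.coe_mulRight] at this
      exact mul_inv_eq_iff_eq_mul.1 this
    · have := hxt (u * t₀) (by simpa using hut)
      simp only [Equiv.trans_apply, Equiv.coe_mulRight]
      rw [← mul_assoc, this]
      group
  have hmem : (x : Perm α) ∈ Subgroup.closure {σ : Perm α | IsThreeCycle σ} := by
    rw [closure_three_cycles_eq_alternating]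
    exact x.2
  have key : ∀ y ∈ Subgroup.closure {σ : Perm α | IsThreeCycle σ}, ∀ hy : y ∈ alternatingGroup α,
      F ⟨y, hy⟩ = ⟨y, hy⟩ ∧ ∀ t : alternatingGroup α, (t : Perm α).IsThreeCycle →
        F (t * ⟨y, hy⟩) = t * ⟨y, hy⟩ := by
    intro y hy
    induction hy using Subgroup.closure_induction_left with
    | one => exact fun _ => ⟨h1, fun t ht => (mul_one t).symm ▸ hfix t ht⟩
    | mul_left t ht y hy ih =>
      rw [closure_three_cycles_eq_alternating] at hy
      exact fun _ => step ⟨y, hy⟩ ⟨t, IsThreeCycle.mem_alternatingGroup ht⟩ ht (ih hy)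
    | inv_mul_cancel t ht y hy ih =>
      rw [closure_three_cycles_eq_alternating] at hy
      exact fun _ => step ⟨y, hy⟩ ⟨t⁻¹, IsThreeCycle.mem_alternatingGroup (IsThreeCycle.inv ht)⟩
        (IsThreeCycle.inv ht) (ih hy)
  exact (key x hmem x.2).1

/-- The permutations of the alternating group that are built from a conjugation, an optional
inversion, and a right translation. -/
def cayleyMap (d : Perm α × Bool × alternatingGroup α) (x : alternatingGroup α) :
    alternatingGroup α :=
  MulAut.conjNormal d.1 (if d.2.1 then x⁻¹ else x) * d.2.2

theorem PreservesCayley.exists_eq_cayleyMap (hα : 5 ≤ Fintype.card α)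
    {F : alternatingGroup α ≃ alternatingGroup α} (hF : PreservesCayley F) :
    ∃ d, ⇑F = cayleyMap d := by
  have hG := hF.trans (preservesCayley_mulRight (F 1)⁻¹)
  set G := F.trans (Equiv.mulRight (F 1)⁻¹) with hGdef
  have hG1 : G 1 = 1 := by simp [hGdef]
  have finish : ∀ H : alternatingGroup α ≃ alternatingGroup α, PreservesCayley H → H 1 = 1 →
      (∀ s : alternatingGroup α, (s : Perm α).IsThreeCycle → G s = H s) →
      ∀ x, F x = H x * F 1 := by
    intro H hH hH1 hs x
    have := (hG.trans hH.symm).eq_refl hα (by simp [hG1, Equiv.symm_apply_eq, hH1])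
      (fun t ht => by simp [hs t ht]) x
    rw [Equiv.trans_apply, Equiv.symm_apply_eq] at this
    rw [← this]
    simp [hGdef]
  obtain ⟨σ, h | h⟩ := hG.exists_conj hα hG1
  · refine ⟨(σ, false, F 1), funext fun x => ?_⟩
    rw [finish _ (preservesCayley_conj σ) (map_one (MulAut.conjNormal σ)) (fun s hs => Subtype.ext (h s hs)) x]
    rfl
  · refine ⟨(σ, true, F 1), funext fun x => ?_⟩
    rw [finish _ (preservesCayley_inv.trans (preservesCayley_conj σ)) (by simp)
      (fun s hs => Subtype.ext (h s hs)) x]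
    rfl

end ThreeCycle

/-! ### Counting the automorphisms -/

theorem CAG_adj_iff {n : ℕ} (u v : alternatingGroup (Fin n)) :
    (CAG n).Adj u v ↔ ((v * u⁻¹ : alternatingGroup (Fin n)) : Equiv.Perm (Fin n)).IsThreeCycle := by
  constructor
  · rintro ⟨t, ht, rfl⟩
    rw [mul_inv_cancel_right]
    exact ht
  · exact fun h => ⟨v * u⁻¹, h, by simp⟩

theorem preservesCayley_of_aut {n : ℕ} (f : CAG n ≃g CAG n) :
    ThreeCycle.PreservesCayley f.toEquiv := fun u v => by
  rw [← CAG_adj_iff, ← CAG_adj_iff]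
  exact f.map_rel_iff.symm

theorem corollary3p1 (n : ℕ) (hn : 5 ≤ n) :
    Nat.card (CAG n ≃g CAG n) ≤ (n !) ^ 2 := by
  have hα : 5 ≤ Fintype.card (Fin n) := by simpa using hn
  have : Nontrivial (Fin n) := Fin.nontrivial_iff_two_le.2 (by omega)
  choose d hd using fun f : CAG n ≃g CAG n => (preservesCayley_of_aut f).exists_eq_cayleyMap hα
  -- The upper bound needs only that the data determine the automorphism.
  have hinj : Function.Injective d := fun f g hfg =>
    DFunLike.coe_injective ((hd f).trans ((congrArg _ hfg).trans (hd g).symm))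
  refine (Nat.card_le_card_of_injective d hinj).trans (le_of_eq ?_)
  have h2 := two_mul_nat_card_alternatingGroup (α := Fin n)
  rw [Nat.card_prod, Nat.card_prod, Nat.card_eq_fintype_card (α := Bool), Fintype.card_bool, h2,
    Nat.card_perm, Nat.card_eq_fintype_card, Fintype.card_fin, sq]
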